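/- For $n$-bit integers $X=\sum_{i=1}^n 2^{i-1}x_i$ and $Y=\sum_{i=1}^n 2^{i-1}y_i$ with $x_i,y_i\in\{0,1\}$ let $\mathrm{COMP}(X,Y)=\mathbb{1}\{X\ge Y\}$. A linear threshold gate computes $\mathbb{1}\{\sum_i w_iz_i\ge b\}$ of its binary inputs $z_i$, with integer weights $w_i$ and an integer bias $b$; a depth-2 linear threshold circuit consists of a first layer of such gates reading the input bits $x_1,\dots,x_n,y_1,\dots,y_n$ and a top gate reading the outputs of the first layer. Its size is the total number of gates, and its weight size is the largest absolute value of a weight (biases are not counted). An integer matrix with $n$ columns is an $\mathrm{EQ}_q$ matrix if $Ax=0$ has no non-zero solution $x\in\{-q+1,\dots,q-1\}^n$, and $A\in\mathbb{Z}^{rm\times n}$ is an $\mathrm{RMDS}_q$ matrix with MDS rate $r$ and EQ rate $n/m$ if every $m\times n$ submatrix of $A$ is an $\mathrm{EQ}_q$ matrix. Given $A\in\mathbb{Z}^{nm\times n}$ (that is, $r=n$), let $A^{(l)}$ be the matrix of its first $n-l$ columns, $a_{n-l}$ its $(n-l)$-th column, and $(X-Y)^{(l)}=(x_n-y_n,\,x_{n-1}-y_{n-1},\dots,x_{l+1}-y_{l+1})^T$.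 For $0\le l\le n-1$ and $1\le i\le nm$ put $z_{l,i}=\mathbb{1}\{(A^{(l)}(X-Y)^{(l)})_i=-(a_{n-l})_i\}$. Let $\mathcal{C}(A)$ be the depth-2 linear threshold circuit that computes $\mathbb{1}\{\sum_{l,i}z_{l,i}\le n(m-1)\}$, where every $z_{l,i}$ is written as $\mathbb{1}\{F\ge 0\}+\mathbb{1}\{-F\ge 0\}-1$ with $F=(A^{(l)}(X-Y)^{(l)})_i+(a_{n-l})_i$, the two indicators are gates of the first layer, and the constants $-1$ are absorbed in the bias of the top gate. Then: 1. For all $n,m$ and every $\mathrm{RMDS}_3$ matrix $A\in\mathbb{Z}^{nm\times n}$ (MDS rate $r=n$), the circuit $\mathcal{C}(A)$ computes $\mathrm{COMP}$ of two $n$-bit integers. 2. There is an absolute constant $C>0$ such that for every $n\ge 2$ there are $m\le C\,n/\log n$, $W\le C\,n$ and an $\mathrm{RMDS}_3$ matrix $A\in\mathbb{Z}^{nm\times n}$ with all entries in $\{-W,\dots,W\}$. For this $A$ the circuit $\mathcal{C}(A)$ computes $\mathrm{COMP}$ of two $n$-bit integers, has weight size at most $W=O(n)$ in both layers, and has $2n^2m+1\le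 C\,n^3/\log n$ gates. -/

import Mathlib

/-- `A` is an `EQ_q` matrix: the system `A x = 0` has no non-trivial solution `x` whose entries
lie in `{-q+1, …, q-1}`. -/
def IsEQMatrix {μ : Type*} {n : ℕ} (q : ℕ) (A : Matrix μ (Fin n) ℤ) : Prop :=
  ∀ x : Fin n → ℤ, (∀ j, -(q : ℤ) + 1 ≤ x j ∧ x j ≤ (q : ℤ) - 1) →
    Matrix.mulVec A x = 0 → x = 0

/-- `A`, with `N` rows, is an `RMDS_q` matrix with EQ rate `n / m` and MDS rate `N / m`: every
`m × n` submatrix (a choice of `m` distinct rows) is an `EQ_q` matrix. -/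
def IsRMDS {N n : ℕ} (q m : ℕ) (A : Matrix (Fin N) (Fin n) ℤ) : Prop :=
  ∀ f : Fin m ↪ Fin N, IsEQMatrix q (A.submatrix f id)

/-- A linear threshold gate with inputs indexed by `ι`: integer weights and an integer bias. -/
structure LTGate (ι : Type) where
  weight : ι → ℤ
  bias : ℤ

/-- The gate computes the indicator of `∑ wᵢ xᵢ ≥ b` on `{0,1}` inputs. -/
def LTGate.eval {ι : Type} [Fintype ι] (g : LTGate ι) (x : ι → Bool) : Bool :=
  decide (∑ i, g.weight i * (x i).toInt ≥ g.bias)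

/-- A depth-2 linear threshold circuit on inputs `ι`: a first layer of linear threshold gates
indexed by `κ`, reading the inputs, and a top linear threshold gate reading the first layer. -/
structure DepthTwoCircuit (ι κ : Type) where
  layer : κ → LTGate ι
  top : LTGate κ

namespace DepthTwoCircuit

variable {ι κ : Type}

/-- The output of the circuit. -/
def eval [Fintype ι] [Fintype κ] (c : DepthTwoCircuit ι κ) (x : ι → Bool) : Bool :=
  c.top.eval fun k => (c.layer k).eval x

/-- The number of gates, including the top gate. -/
def size [Fintype κ] (_c : DepthTwoCircuit ι κ) : ℕ := Fintype.card κ + 1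

/-- All weights (in both layers; biases are not counted) are at most `W` in absolute value. -/
def WeightsLE (c : DepthTwoCircuit ι κ) (W : ℕ) : Prop :=
  (∀ k i, |(c.layer k).weight i| ≤ (W : ℤ)) ∧ ∀ k, |c.top.weight k| ≤ (W : ℤ)

end DepthTwoCircuit

/-- The integer with binary digits `x`, where `x 0` is the least significant bit. -/
def bitsValue {n : ℕ} (x : Fin n → Bool) : ℕ :=
  ∑ i : Fin n, 2 ^ (i : ℕ) * (x i).toNat

/-- The COMPARISON function, the indicator of `X ≥ Y`. -/
def COMP {n : ℕ} (x y : Fin n → Bool) : Bool := decide (bitsValue x ≥ bitsValue y)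

/-- A depth-2 circuit on the `2n` input bits of `X` and `Y` computes `COMP`. -/
def DepthTwoCircuit.ComputesCOMP {n : ℕ} {κ : Type} [Fintype κ]
    (c : DepthTwoCircuit (Fin n ⊕ Fin n) κ) : Prop :=
  ∀ x y : Fin n → Bool, c.eval (Sum.elim x y) = COMP x y

/-- The weights of the linear form that sends `(X, Y)` to the `i`-th entry of
`A⁽ˡ⁾ (X - Y)⁽ˡ⁾`. Here `(X - Y)⁽ˡ⁾` is the vector of the `n - l` most significant digits of the
difference, listed from the most significant one down to digit `l`, and `A⁽ˡ⁾` consists of the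
first `n - l` columns of `A`. So digit `k ≥ l` meets the column `Fin.rev k`, which has index
`n - 1 - k`. -/
def compForm {N n : ℕ} (A : Matrix (Fin N) (Fin n) ℤ) (l : Fin n) (i : Fin N) :
    Fin n ⊕ Fin n → ℤ
  | .inl k => if l ≤ k then A i k.rev else 0
  | .inr k => if l ≤ k then -A i k.rev else 0

/-- The depth-2 circuit built from a matrix `A` with `N` rows and the parameter `m`. For every
`l` and every row `i` put
`z l i = 1` if `(A⁽ˡ⁾ (X - Y)⁽ˡ⁾) i = - A i (n - 1 - l)` (the last column of `A⁽ˡ⁾`), else `0`.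
Each `z l i` is `u + v - 1` for two linear threshold gates `u`, `v` of the first layer (one for
each inequality), and the top gate tests `∑ z l i ≤ n (m - 1)`, with the `n N` summands `-1`
absorbed in its bias. -/
def compCircuit {N n : ℕ} (m : ℕ) (A : Matrix (Fin N) (Fin n) ℤ) :
    DepthTwoCircuit (Fin n ⊕ Fin n) (Fin n × Fin N × Bool) where
  layer := fun p =>
    if p.2.2 then ⟨compForm A p.1 p.2.1, -A p.2.1 p.1.rev⟩
    else ⟨-compForm A p.1 p.2.1, A p.2.1 p.1.rev⟩
  top := ⟨fun _ => -1, -((n : ℤ) * N + n * ((m : ℤ) - 1))⟩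

/-!
**Correctness.** The gates `u`, `v` of a pair `(l, i)` satisfy `u + v - 1 = 1` exactly when the
`i`-th entry of `A w` vanishes, where `w = shiftedDiff x y l` is the vector of the digits of `X - Y`
from the top down to digit `l`, with `1` added to digit `l`. Its entries lie in `{-2, …, 2}`, so if
`w ≠ 0`, then the `RMDS_3` property leaves at most `m - 1` zero entries (`IsRMDS.card_zero_lt`). But
`w = 0` says that `X` and `Y` agree above digit `l` and have there the digits `0` and `1`. Some `l`
does this if and only if `X < Y`, and then all `n m > n (m - 1)` indicators for this `l` are `1`.

**Existence.** Take the entries to be `M b + c` with independent uniform bits `b` and residues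
`c ∈ {0, …, M - 1}`, where `M = 10 n + 1` is odd. Let `x` be a non-zero vector over `{-2, …, 2}`
with `s` non-zero entries, all of them units modulo `M`. A row is orthogonal to `x` only if the
linear form of its residues vanishes modulo `M`, an event of probability `1 / M`, and then the bits
have to solve an equation `∑ bⱼ xⱼ = t`, which by the Littlewood–Offord bound has probability at
most `1 / √(s + 1)` (`card_orthogonalRows_sqrt_le`). As there are at most `(3 n) ^ m` sets of `m`
rows, the union bound leaves the sum of `(1 / (3 √(s + 1))) ^ m` over all `x`
(`exists_isRMDS_of_sum_lt`, `union_bound_term_le`), which is less than `1` for `m ≥ 32 n / log n`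
(`sum_inv_sqrt_pow_lt`).
-/

open Finset

/-! ### Comparison of binary numbers -/

theorem bitsValue_eq_ofBits : ∀ {n : ℕ} (x : Fin n → Bool), bitsValue x = Nat.ofBits x
  | 0, x => by simp [bitsValue]
  | n + 1, x => by
    rw [Nat.ofBits_succ, ← bitsValue_eq_ofBits, bitsValue, Fin.sum_univ_succ, bitsValue,
      Finset.mul_sum, add_comm]
    simp [pow_succ', mul_assoc]

theorem bitsValue_lt_of_top_difference {n : ℕ} {x y : Fin n → Bool} (l : Fin n)
    (hx : x l = false) (hy : y l = true) (h : ∀ k, l < k → x k = y k) :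
    bitsValue x < bitsValue y := by
  rw [bitsValue_eq_ofBits, bitsValue_eq_ofBits]
  refine Nat.lt_of_testBit l ?_ ?_ fun j hj => ?_
  · rw [Nat.testBit_ofBits_lt _ _ l.2, hx]
  · rw [Nat.testBit_ofBits_lt _ _ l.2, hy]
  · by_cases hjn : j < n
    · rw [Nat.testBit_ofBits_lt _ _ hjn, Nat.testBit_ofBits_lt _ _ hjn]
      exact h ⟨j, hjn⟩ hj
    · rw [Nat.testBit_ofBits_ge _ _ (by omega), Nat.testBit_ofBits_ge _ _ (by omega)]

theorem bitsValue_lt_iff {n : ℕ} (x y : Fin n → Bool) :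
    bitsValue x < bitsValue y ↔
      ∃ l, x l = false ∧ y l = true ∧ ∀ k, l < k → x k = y k := by
  refine ⟨fun h => ?_, fun ⟨l, hx, hy, hl⟩ => bitsValue_lt_of_top_difference l hx hy hl⟩
  have hne : (univ.filter fun k => x k ≠ y k).Nonempty := by
    by_contra hcon
    rw [not_nonempty_iff_eq_empty, filter_eq_empty_iff] at hcon
    have : x = y := funext fun k => by simpa using hcon (mem_univ k)
    exact absurd h (by simp [this])
  obtain ⟨l, hl, hmax⟩ := exists_max_image _ id hne
  have htop : ∀ k, l < k → x k = y k := fun k hk => by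
    by_contra hcon
    exact absurd (hmax k (by simpa using hcon)) (not_le.2 hk)
  have hl' : x l ≠ y l := by simpa using hl
  rcases hxl : x l with _ | _
  · exact ⟨l, hxl, by rw [hxl] at hl'; simpa using hl'.symm, htop⟩
  · have hyl : y l = false := by rw [hxl] at hl'; simpa using hl'.symm
    exact absurd h (bitsValue_lt_of_top_difference l hyl hxl fun k hk => (htop k hk).symm).not_gt

/-! ### The circuit of an RMDS matrix -/

/-- The vector `(X - Y)⁽ˡ⁾`, padded with zeros to length `n`, with `1` added to its last digit `l`.
Coordinate `j` holds digit `Fin.rev j`. -/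
def shiftedDiff {n : ℕ} (x y : Fin n → Bool) (l : Fin n) (j : Fin n) : ℤ :=
  if l ≤ j.rev then (x j.rev).toInt - (y j.rev).toInt + (if j.rev = l then 1 else 0) else 0

theorem mulVec_shiftedDiff {N n : ℕ} (A : Matrix (Fin N) (Fin n) ℤ) (x y : Fin n → Bool)
    (l : Fin n) (i : Fin N) :
    A.mulVec (shiftedDiff x y l) i =
      ∑ k, compForm A l i k * (Sum.elim x y k).toInt + A i l.rev := by
  have hl : A i l.rev = ∑ k : Fin n, if k = l then A i k.rev else 0 := by simp
  rw [hl, Fintype.sum_sum_type, ← sum_add_distrib, ← sum_add_distrib, Matrix.mulVec, dotProduct,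
    ← Equiv.sum_comp Fin.revPerm]
  refine sum_congr rfl fun k _ => ?_
  simp only [Fin.revPerm_apply, shiftedDiff, Fin.rev_rev, compForm, Sum.elim_inl, Sum.elim_inr]
  by_cases h : l ≤ k
  · by_cases h' : k = l <;> simp [h, h'] <;> ring
  · have : k ≠ l := fun e => h e.ge
    simp [h, this]

theorem shiftedDiff_bound {n : ℕ} (x y : Fin n → Bool) (l j : Fin n) :
    -2 ≤ shiftedDiff x y l j ∧ shiftedDiff x y l j ≤ 2 := by
  unfold shiftedDiff
  cases x j.rev <;> cases y j.rev <;> split_ifs <;> simp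

theorem shiftedDiff_eq_zero_iff {n : ℕ} (x y : Fin n → Bool) (l : Fin n) :
    shiftedDiff x y l = 0 ↔ x l = false ∧ y l = true ∧ ∀ k, l < k → x k = y k := by
  constructor
  · intro h
    have hk : ∀ k, l ≤ k →
        (x k).toInt - (y k).toInt + (if k = l then 1 else 0) = 0 := fun k hk => by
      simpa [shiftedDiff, hk] using congrFun h k.rev
    have h0 := hk l le_rfl
    refine ⟨?_, ?_, fun k hlk => ?_⟩
    · cases hx : x l <;> cases hy : y l <;> simp [hx, hy] at h0 ⊢
    · cases hx : x l <;> cases hy : y l <;> simp [hx, hy] at h0 ⊢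
    · have h1 := hk k hlk.le
      rw [if_neg hlk.ne'] at h1
      cases hx : x k <;> cases hy : y k <;> simp [hx, hy] at h1 ⊢
  · rintro ⟨hx, hy, h⟩
    funext j
    unfold shiftedDiff
    split_ifs with h1 h2
    · simp [h2, hx, hy]
    · simp [h j.rev (lt_of_le_of_ne h1 (Ne.symm h2))]
    · rfl

/-- In the product of an `RMDS_q` matrix with a non-zero vector of small entries fewer than `m`
entries vanish, since `m` vanishing entries would select an `m × n` submatrix that kills it. -/
theorem IsRMDS.card_zero_lt {N n q m : ℕ} {A : Matrix (Fin N) (Fin n) ℤ} (hA : IsRMDS q m A)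
    {v : Fin n → ℤ} (hv : ∀ j, -(q : ℤ) + 1 ≤ v j ∧ v j ≤ (q : ℤ) - 1) (hv0 : v ≠ 0) :
    #{i | A.mulVec v i = 0} < m := by
  by_contra! hcon
  obtain ⟨T, hT, hTm⟩ := exists_subset_card_eq hcon
  let f : Fin m ↪ Fin N := (T.orderEmbOfFin hTm).toEmbedding
  refine hv0 (hA f v hv ?_)
  funext i
  have := hT (T.orderEmbOfFin_mem hTm i)
  simpa [Matrix.mulVec, dotProduct, Matrix.submatrix, f] using this

theorem compCircuit_eval_iff {N n : ℕ} (m : ℕ) (A : Matrix (Fin N) (Fin n) ℤ)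
    (x y : Fin n → Bool) :
    (compCircuit m A).eval (Sum.elim x y) = true ↔
      ∑ l, (#{i | A.mulVec (shiftedDiff x y l) i = 0} : ℤ) ≤ n * ((m : ℤ) - 1) := by
  have hpair : ∀ (l : Fin n) (i : Fin N),
      (((compCircuit m A).layer (l, i, true)).eval (Sum.elim x y)).toInt +
        (((compCircuit m A).layer (l, i, false)).eval (Sum.elim x y)).toInt =
      1 + if A.mulVec (shiftedDiff x y l) i = 0 then 1 else 0 := by
    intro l i
    rw [mulVec_shiftedDiff]
    simp only [compCircuit, LTGate.eval, if_true, Bool.false_eq_true, if_false, Pi.neg_apply,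
      neg_mul, sum_neg_distrib]
    generalize (∑ k, compForm A l i k * (Sum.elim x y k).toInt) = S
    generalize A i l.rev = a
    rcases lt_trichotomy (S + a) 0 with h | h | h
    · simp [show ¬ -a ≤ S by omega, show a ≤ -S by omega, h.ne]
    · simp [show -a ≤ S by omega, show a ≤ -S by omega, h]
    · simp [show -a ≤ S by omega, show ¬ a ≤ -S by omega, h.ne']
  have hsum : ∑ k, (((compCircuit m A).layer k).eval (Sum.elim x y)).toInt =
      (n : ℤ) * N + ∑ l, (#{i | A.mulVec (shiftedDiff x y l) i = 0} : ℤ) := by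
    simp only [Fintype.sum_prod_type, Fintype.sum_bool, hpair, sum_add_distrib, sum_boole,
      sum_const, card_univ, Fintype.card_fin, nsmul_eq_mul, mul_one]
  have : (compCircuit m A).eval (Sum.elim x y) =
      decide (-∑ k, (((compCircuit m A).layer k).eval (Sum.elim x y)).toInt ≥
        -((n : ℤ) * N + n * ((m : ℤ) - 1))) := by
    simp only [DepthTwoCircuit.eval, LTGate.eval, ← sum_neg_distrib]
    simp [compCircuit]
  rw [this, hsum, decide_eq_true_iff]
  constructor <;> intro h <;> linarith

theorem computesCOMP_of_isRMDS {n m : ℕ} {A : Matrix (Fin (n * m)) (Fin n) ℤ}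
    (hA : IsRMDS 3 m A) : (compCircuit m A).ComputesCOMP := by
  intro x y
  rw [Bool.eq_iff_iff, compCircuit_eval_iff, COMP, decide_eq_true_iff, ge_iff_le, ← not_lt,
    ← not_lt, not_iff_not, bitsValue_lt_iff]
  simp only [← shiftedDiff_eq_zero_iff]
  constructor
  · intro h
    by_contra! hcon
    refine h.not_ge ?_
    have : ∀ l, (#{i | A.mulVec (shiftedDiff x y l) i = 0} : ℤ) ≤ (m : ℤ) - 1 := fun l => by
      have := hA.card_zero_lt (v := shiftedDiff x y l)
        (fun j => by simpa using shiftedDiff_bound x y l j) (hcon l)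
      omega
    calc _ ≤ ∑ _l : Fin n, ((m : ℤ) - 1) := sum_le_sum fun l _ => this l
      _ = _ := by rw [sum_const, card_univ, Fintype.card_fin, nsmul_eq_mul]
  · rintro ⟨l, hl⟩
    have hn : (0 : ℤ) < n := by exact_mod_cast l.pos
    calc (n : ℤ) * ((m : ℤ) - 1) < n * m := by nlinarith
      _ = (#{i | A.mulVec (shiftedDiff x y l) i = 0} : ℤ) := by simp [hl]
      _ ≤ _ := single_le_sum (f := fun l => (#{i | A.mulVec (shiftedDiff x y l) i = 0} : ℤ))
          (fun _ _ => by positivity) (mem_univ l)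

/-! ### The Littlewood–Offord bound -/

theorem centralBinom_sq_mul_le (k : ℕ) : k.centralBinom ^ 2 * (2 * k + 1) ≤ 4 ^ (2 * k) := by
  induction k with
  | zero => simp
  | succ k ih =>
    have h := Nat.succ_mul_centralBinom_succ k
    have h2 : ((k + 1) * (k + 1).centralBinom) ^ 2 * (2 * (k + 1) + 1) ≤
        (k + 1) ^ 2 * 4 ^ (2 * (k + 1)) := by
      rw [h]
      calc (2 * (2 * k + 1) * k.centralBinom) ^ 2 * (2 * (k + 1) + 1)
          = (4 * (2 * k + 1) * (2 * k + 3)) * (k.centralBinom ^ 2 * (2 * k + 1)) := by ring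
        _ ≤ (16 * (k + 1) ^ 2) * 4 ^ (2 * k) := Nat.mul_le_mul (by nlinarith) ih
        _ = _ := by ring
    rw [mul_pow, mul_assoc] at h2
    exact Nat.le_of_mul_le_mul_left h2 (by positivity)

/-- Squared form of `s.choose (s / 2) / 2 ^ s ≤ 1 / √(s + 1)`. -/
theorem choose_half_sq_mul_le (s : ℕ) : s.choose (s / 2) ^ 2 * (s + 1) ≤ 4 ^ s := by
  rcases Nat.even_or_odd' s with ⟨k, rfl | rfl⟩
  · simpa [Nat.centralBinom] using centralBinom_sq_mul_le k
  · have h := centralBinom_sq_mul_le (k + 1)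
    have h2 : (k + 1).centralBinom = 2 * (2 * k + 1).choose k := by
      rw [Nat.centralBinom, show 2 * (k + 1) = (2 * k + 1) + 1 by ring, Nat.choose_succ_succ,
        Nat.choose_symm_half]
      ring
    rw [h2] at h
    rw [show (2 * k + 1) / 2 = k by omega]
    have : 4 ^ (2 * (k + 1)) = 4 * 4 ^ (2 * k + 1) := by ring
    rw [this] at h
    nlinarith

/-- The Littlewood–Offord bound of Erdős: flipping the signs of the negative coefficients turns
the solutions into an antichain of subsets, to which Sperner's theorem applies. -/
theorem card_subset_sum_le {α : Type*} [Fintype α] [DecidableEq α] (x : α → ℤ)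
    (hx : ∀ j, x j ≠ 0) (t : ℤ) :
    #{b : α → Bool | ∑ j, (if b j then x j else 0) = t} ≤
      (Fintype.card α).choose (Fintype.card α / 2) := by
  -- With `B b` as below, `∑ b j * x j` is `∑_{j ∈ B b} |x j|` up to a constant.
  let B : (α → Bool) → Finset α := fun b => {j | b j = decide (0 < x j)}
  have hsum : ∀ b, ∑ j ∈ B b, |x j| = (∑ j, if b j then x j else 0) - ∑ j, min (x j) 0 := by
    intro b
    rw [sum_filter, ← sum_sub_distrib]
    refine sum_congr rfl fun j _ => ?_
    rcases lt_or_gt_of_ne (hx j) with h | h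
    · cases b j <;> simp [abs_of_neg h, h.le, h.not_gt]
    · cases b j <;> simp [abs_of_pos h, h.le, h]
  have hinj : Function.Injective B := by
    intro b b' h
    funext j
    have := Finset.ext_iff.1 h j
    simp only [B, mem_filter, mem_univ, true_and] at this
    revert this
    cases b j <;> cases b' j <;> cases decide (0 < x j) <;> simp
  rw [← card_image_of_injective _ hinj]
  refine IsAntichain.sperner ?_
  intro S hS T hT hne hsub
  simp only [coe_image, coe_filter, mem_univ, true_and, Set.mem_image, Set.mem_ofPred_eq] at hS hT
  obtain ⟨b, hb, rfl⟩ := hS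
  obtain ⟨b', hb', rfl⟩ := hT
  have hss : B b ⊂ B b' := lt_of_le_of_ne hsub hne
  obtain ⟨j, hj', hj⟩ := exists_of_ssubset hss
  have := sum_lt_sum_of_subset hsub hj' hj (abs_pos.2 (hx j))
    fun k _ _ => abs_nonneg (x k)
  rw [hsum, hsum, hb, hb'] at this
  exact lt_irrefl _ this

/-! ### Rows orthogonal to a given vector -/

/-- The number of non-zero entries of an integer vector. -/
def suppCard {n : ℕ} (x : Fin n → ℤ) : ℕ := #{j | x j ≠ 0}

theorem suppCard_le {n : ℕ} (x : Fin n → ℤ) : suppCard x ≤ n :=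
  (card_le_univ _).trans_eq (Fintype.card_fin n)

theorem card_bool_solutions_le {n : ℕ} (x : Fin n → ℤ) (t : ℤ) :
    #{b : Fin n → Bool | ∑ j, (if b j then x j else 0) = t} ≤
      2 ^ (n - suppCard x) * (suppCard x).choose (suppCard x / 2) := by
  have hcard : Fintype.card {j // x j ≠ 0} = suppCard x := Fintype.card_subtype _
  have hcard' : Fintype.card {j // ¬ x j ≠ 0} = n - suppCard x := by
    rw [Fintype.card_subtype_compl, hcard, Fintype.card_fin]
  have h := card_subset_sum_le (fun j : {j // x j ≠ 0} => x j) (fun j => j.2) t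
  rw [hcard] at h
  refine le_trans ?_ (Nat.mul_le_mul_left _ h)
  have : 2 ^ (n - suppCard x) = #(univ : Finset ({j // ¬ x j ≠ 0} → Bool)) := by
    rw [card_univ, Fintype.card_fun, hcard', Fintype.card_bool]
  rw [this, ← card_product]
  refine card_le_card_of_injOn (fun b => (fun j => b j, fun j => b j)) ?_ ?_
  · intro b hb
    simp only [coe_filter, mem_univ, true_and, Set.mem_ofPred_eq] at hb
    simp only [coe_product, Set.mem_prod, coe_univ, Set.mem_univ, true_and, coe_filter, mem_univ,
      Set.mem_ofPred_eq]
    rw [← hb, ← Fintype.sum_subtype_add_sum_subtype (fun j => x j ≠ 0)]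
    rw [left_eq_add]
    refine sum_eq_zero fun j _ => ?_
    have := j.2
    simp only [ne_eq, not_not] at this
    simp [this]
  · intro b _ b' _ h
    simp only [Prod.mk.injEq] at h
    funext j
    by_cases hj : x j ≠ 0
    · exact congrFun h.2 ⟨j, hj⟩
    · exact congrFun h.1 ⟨j, hj⟩

/-- A linear form over `ZMod M` with a unit coefficient takes each value equally often. -/
theorem card_zmod_solutions_mul_le {n M : ℕ} [NeZero M] (x : Fin n → ZMod M) (j₀ : Fin n)
    (hj₀ : IsUnit (x j₀)) :
    #{c : Fin n → ZMod M | ∑ j, c j * x j = 0} * M ≤ M ^ n := by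
  have hM : M = #(univ : Finset (ZMod M)) := by rw [card_univ, ZMod.card]
  have hMn : M ^ n = #(univ : Finset (Fin n → ZMod M)) := by
    rw [card_univ, Fintype.card_fun, ZMod.card, Fintype.card_fin]
  refine (Nat.mul_le_mul_left _ hM.le).trans ?_
  rw [hMn, ← card_product]
  -- Adding `z` to the coordinate `j₀` of a solution gives a point from which `z` can be recovered.
  refine card_le_card_of_injOn
    (fun p => (p.1 + Pi.single j₀ p.2 : Fin n → ZMod M)) (fun _ _ => by simp) ?_
  have key : ∀ (c : Fin n → ZMod M) (z : ZMod M), ∑ j, c j * x j = 0 →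
      ∑ j, (c + Pi.single j₀ z : Fin n → ZMod M) j * x j = z * x j₀ := by
    intro c z hc
    simp [add_mul, sum_add_distrib, hc, Pi.single_apply]
  rintro ⟨c, z⟩ hc ⟨c', z'⟩ hc' h
  simp only [coe_product, Set.mem_prod, coe_filter, mem_univ, true_and, Set.mem_ofPred_eq] at hc hc'
  have hz : z = z' := hj₀.mul_left_injective (by
    simp only [← key c z hc.1, ← key c' z' hc'.1]
    exact sum_congr rfl fun j _ => by rw [show c + Pi.single j₀ z = c' + Pi.single j₀ z' from h])
  subst hz
  simpa using h

/-- The integer `M b + c` encoded by a bit `b` and a residue `c` modulo `M`; over all pairs it runs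
through `0, …, 2 M - 1`. -/
def digitEntry {M : ℕ} (p : Bool × ZMod M) : ℤ := (if p.1 then (M : ℤ) else 0) + p.2.val

/-- The rows, encoded by bits and residues, that are orthogonal to `x`. -/
def orthogonalRows {n : ℕ} (M : ℕ) [NeZero M] (x : Fin n → ℤ) :
    Finset (Fin n → Bool × ZMod M) :=
  {r | ∑ j, digitEntry (r j) * x j = 0}

/-- Reduction modulo `M` confines the residues to the zeros of a linear form over `ZMod M`; once
they are fixed, the bits solve a Littlewood–Offord equation. -/
theorem card_orthogonalRows_mul_le {n M : ℕ} [NeZero M] (x : Fin n → ℤ) (j₀ : Fin n)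
    (hj₀ : IsUnit (x j₀ : ZMod M)) :
    #(orthogonalRows M x) * M ≤
      M ^ n * (2 ^ (n - suppCard x) * (suppCard x).choose (suppCard x / 2)) := by
  set K := 2 ^ (n - suppCard x) * (suppCard x).choose (suppCard x / 2)
  have h : #(orthogonalRows M x) ≤
      K * #{c : Fin n → ZMod M | ∑ j, c j * (x j : ZMod M) = 0} := by
    refine card_le_mul_card_image_of_maps_to (f := fun r j => (r j).2) ?_ K ?_
    · intro r hr
      simp only [orthogonalRows, mem_filter, mem_univ, true_and] at hr ⊢
      have := congrArg (Int.cast : ℤ → ZMod M) hr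
      simpa [digitEntry, apply_ite (Int.cast : ℤ → ZMod M)] using this
    · intro c _
      refine le_trans ?_ (card_bool_solutions_le x
        (-((∑ j, ((c j).val : ℤ) * x j) / M)))
      refine card_le_card_of_injOn (fun r j => (r j).1) ?_ ?_
      · intro r hr
        simp only [coe_filter, orthogonalRows, mem_filter, mem_univ, true_and,
          Set.mem_ofPred_eq] at hr ⊢
        obtain ⟨hr, rfl⟩ := hr
        have h0 : (M : ℤ) * ∑ j, (if (r j).1 then x j else 0) +
            ∑ j, ((r j).2.val : ℤ) * x j = 0 := by
          refine Eq.trans ?_ hr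
          rw [mul_sum, ← sum_add_distrib]
          refine sum_congr rfl fun j _ => ?_
          unfold digitEntry
          split_ifs <;> ring
        have hM : (M : ℤ) ≠ 0 := by exact_mod_cast NeZero.ne M
        have : ∑ j, ((r j).2.val : ℤ) * x j =
            M * (-∑ j, (if (r j).1 then x j else 0)) := by linarith
        rw [this, Int.mul_ediv_cancel_left _ hM, neg_neg]
      · intro r hr r' hr' h
        simp only [coe_filter, Set.mem_ofPred_eq] at hr hr'
        funext j
        exact Prod.ext (congrFun h j) (congrFun (hr.2.trans hr'.2.symm) j)
  calc #(orthogonalRows M x) * M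
      ≤ K * #{c : Fin n → ZMod M | ∑ j, c j * (x j : ZMod M) = 0} * M := Nat.mul_le_mul_right _ h
    _ = K * (#{c : Fin n → ZMod M | ∑ j, c j * (x j : ZMod M) = 0} * M) := by ring
    _ ≤ K * M ^ n := Nat.mul_le_mul_left _ (card_zmod_solutions_mul_le _ j₀ hj₀)
    _ = _ := by ring

/-- A uniformly random row is orthogonal to `x`, whose support has size `s`, with probability at
most `1 / (M √(s + 1))`. -/
theorem card_orthogonalRows_sqrt_le {n M : ℕ} [NeZero M] (x : Fin n → ℤ) (j₀ : Fin n)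
    (hj₀ : IsUnit (x j₀ : ZMod M)) :
    (#(orthogonalRows M x) : ℝ) * (M * √(suppCard x + 1 : ℝ)) ≤ (2 * M : ℝ) ^ n := by
  set s := suppCard x with hs
  have h1 : (#(orthogonalRows M x) : ℝ) * M ≤ M ^ n * (2 ^ (n - s) * s.choose (s / 2)) := by
    exact_mod_cast card_orthogonalRows_mul_le x j₀ hj₀
  have h2 : (s.choose (s / 2) : ℝ) * √(s + 1 : ℝ) ≤ 2 ^ s := by
    refine le_of_sq_le_sq ?_ (by positivity)
    rw [mul_pow, Real.sq_sqrt (by positivity), ← pow_mul, mul_comm s, pow_mul]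
    norm_num1
    exact_mod_cast choose_half_sq_mul_le s
  calc (#(orthogonalRows M x) : ℝ) * (M * √(s + 1 : ℝ))
      = (#(orthogonalRows M x) : ℝ) * M * √(s + 1 : ℝ) := by ring
    _ ≤ M ^ n * (2 ^ (n - s) * s.choose (s / 2)) * √(s + 1 : ℝ) := by gcongr
    _ = M ^ n * 2 ^ (n - s) * (s.choose (s / 2) * √(s + 1 : ℝ)) := by ring
    _ ≤ M ^ n * 2 ^ (n - s) * 2 ^ s := by gcongr
    _ = (2 * M : ℝ) ^ n := by
      rw [mul_assoc, ← pow_add, Nat.sub_add_cancel (suppCard_le x), mul_pow, mul_comm]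

/-! ### The union bound -/

/-- The non-zero vectors with entries in `{-2, …, 2}`. -/
noncomputable def smallVectors (n : ℕ) : Finset (Fin n → ℤ) :=
  (Fintype.piFinset fun _ => Icc (-2) 2).erase 0

/-- The union bound over the small vectors and the `m`-sets of rows. -/
theorem exists_isRMDS_of_sum_lt {n m N M : ℕ} [NeZero M] (hmN : m ≤ N)
    (h : ∑ x ∈ smallVectors n,
      (N.choose m : ℝ) * ((#(orthogonalRows M x) : ℝ) / (2 * M : ℝ) ^ n) ^ m < 1) :
    ∃ A : Matrix (Fin N) (Fin n) ℤ, IsRMDS 3 m A ∧ ∀ i j, |A i j| ≤ (2 * M : ℕ) := by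
  classical
  let Row := Fin n → Bool × ZMod M
  have hRow : (Fintype.card Row : ℝ) = (2 * M : ℝ) ^ n := by
    simp [Row, Fintype.card_prod, ZMod.card]
  have hRow0 : (0 : ℝ) < (2 * M : ℝ) ^ n := by
    have : (0 : ℝ) < M := by exact_mod_cast NeZero.pos M
    positivity
  -- `bad x T` is the event that all rows in `T` are orthogonal to `x`.
  let bad : (Fin n → ℤ) → Finset (Fin N) → Finset (Fin N → Row) := fun x T =>
    Fintype.piFinset fun i => if i ∈ T then orthogonalRows M x else univ
  let badAll : Finset (Fin N → Row) :=
    (smallVectors n).biUnion fun x => (powersetCard m univ).biUnion fun T => bad x T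
  have hbad : ∀ x, ∀ T ∈ powersetCard m (univ : Finset (Fin N)), (#(bad x T) : ℝ) =
      ((#(orthogonalRows M x) : ℝ) / (2 * M : ℝ) ^ n) ^ m * ((2 * M : ℝ) ^ n) ^ N := by
    intro x T hT
    have hTm := (mem_powersetCard.1 hT).2
    have h1 : #(bad x T) = #(orthogonalRows M x) ^ m * Fintype.card Row ^ (N - m) := by
      simp only [bad, Fintype.card_piFinset, apply_ite card, prod_ite, prod_const, card_univ]
      congr 2
      · simp [hTm]
      · rw [filter_not, card_sdiff_of_subset (filter_subset _ _)]
        simp [hTm]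
    rw [h1, Nat.cast_mul, Nat.cast_pow, Nat.cast_pow, hRow, div_pow, div_mul_eq_mul_div,
      eq_div_iff (by positivity), mul_assoc, ← pow_add, Nat.sub_add_cancel hmN]
  have hcard : (#badAll : ℝ) < Fintype.card (Fin N → Row) := by
    calc (#badAll : ℝ) ≤ ∑ x ∈ smallVectors n, ∑ T ∈ powersetCard m univ, (#(bad x T) : ℝ) := by
          exact_mod_cast card_biUnion_le.trans (sum_le_sum fun x _ => card_biUnion_le)
      _ = (∑ x ∈ smallVectors n, (N.choose m : ℝ) *
            ((#(orthogonalRows M x) : ℝ) / (2 * M : ℝ) ^ n) ^ m) * ((2 * M : ℝ) ^ n) ^ N := by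
          rw [sum_mul]
          refine sum_congr rfl fun x _ => ?_
          rw [sum_congr rfl (hbad x), sum_const, card_powersetCard, card_univ, Fintype.card_fin,
            nsmul_eq_mul, mul_assoc]
      _ < 1 * ((2 * M : ℝ) ^ n) ^ N := by gcongr
      _ = Fintype.card (Fin N → Row) := by
          rw [one_mul, Fintype.card_fun, Nat.cast_pow, hRow, Fintype.card_fin]
  obtain ⟨R, hR⟩ : ∃ R, R ∉ badAll := by
    by_contra! hcon
    rw [eq_univ_of_forall hcon, card_univ] at hcard
    exact lt_irrefl _ hcard
  refine ⟨fun i j => digitEntry (R i j), fun f x hx h0 => ?_, fun i j => ?_⟩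
  · by_contra hne
    refine hR (mem_biUnion.2 ⟨x, ?_, mem_biUnion.2 ⟨univ.map f, ?_, ?_⟩⟩)
    · simp only [smallVectors, mem_erase, Fintype.mem_piFinset, mem_Icc]
      exact ⟨hne, fun j => by simpa using hx j⟩
    · simp [mem_powersetCard]
    · simp only [bad, Fintype.mem_piFinset]
      intro i
      split_ifs with hi
      · obtain ⟨k, -, rfl⟩ := mem_map.1 hi
        simpa [orthogonalRows, Matrix.mulVec, dotProduct, Matrix.submatrix] using congrFun h0 k
      · exact mem_univ _
  · have h1 := ZMod.val_lt (R i j).2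
    simp only [digitEntry]
    rw [abs_of_nonneg (by split_ifs <;> positivity)]
    push_cast
    split_ifs <;> omega

/-- The generating function of the support size over all vectors with entries in `{-2, …, 2}` is
`(1 + 4 a) ^ n`; taking `a` small counts the vectors of small support. -/
theorem sum_smallVectors_pow_le {n : ℕ} {a : ℝ} (ha : 0 ≤ a) :
    ∑ x ∈ smallVectors n, a ^ suppCard x ≤ (1 + 4 * a) ^ n := by
  calc ∑ x ∈ smallVectors n, a ^ suppCard x
      ≤ ∑ x ∈ Fintype.piFinset fun _ : Fin n => Icc (-2 : ℤ) 2, a ^ suppCard x :=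
        sum_le_sum_of_subset_of_nonneg (erase_subset _ _) fun _ _ _ => by positivity
    _ = ∑ x ∈ Fintype.piFinset fun _ : Fin n => Icc (-2 : ℤ) 2,
          ∏ j, if x j ≠ 0 then a else 1 := by
        refine sum_congr rfl fun x _ => ?_
        rw [← prod_filter, prod_const, suppCard]
    _ = ∏ _j : Fin n, ∑ v ∈ Icc (-2 : ℤ) 2, if v ≠ 0 then a else 1 :=
        (prod_univ_sum (fun _ : Fin n => Icc (-2 : ℤ) 2)
          fun _ v => if v ≠ 0 then a else 1).symm
    _ = (1 + 4 * a) ^ n := by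
        have : Icc (-2 : ℤ) 2 = {-2, -1, 0, 1, 2} := by decide
        rw [prod_const, card_univ, Fintype.card_fin, this]
        congr 1
        simp
        ring

theorem choose_mul_le (n m : ℕ) : ((n * m).choose m : ℝ) ≤ (3 * n) ^ m := by
  have he : (m : ℝ) ^ m / m.factorial ≤ 3 ^ m := by
    refine (Real.pow_div_factorial_le_exp _ m.cast_nonneg m).trans ?_
    rw [← Real.exp_one_pow]
    gcongr
    exact Real.exp_one_lt_three.le
  calc ((n * m).choose m : ℝ) ≤ ((n * m : ℕ) : ℝ) ^ m / m.factorial := Nat.choose_le_pow_div _ _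
    _ = n ^ m * ((m : ℝ) ^ m / m.factorial) := by push_cast; ring
    _ ≤ n ^ m * 3 ^ m := by gcongr
    _ = (3 * n) ^ m := by ring

theorem isUnit_intCast_zmod {M : ℕ} (hM : Odd M) {v : ℤ} (hv : v ≠ 0) (h1 : -2 ≤ v)
    (h2 : v ≤ 2) : IsUnit (v : ZMod M) := by
  have htwo : IsUnit (2 : ZMod M) := by
    have := (ZMod.isUnit_iff_coprime 2 M).2 (Nat.coprime_two_left.2 hM)
    exact_mod_cast this
  have : v = -2 ∨ v = -1 ∨ v = 1 ∨ v = 2 := by omega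
  rcases this with rfl | rfl | rfl | rfl
  · simpa using htwo
  · simp
  · simp
  · simpa using htwo

/-- With `M ≥ 9 n` the row probability `1 / (M √(s + 1))` absorbs the number `≤ (3 n)ᵐ` of sets of
`m` rows. -/
theorem union_bound_term_le {n m M : ℕ} [NeZero M] (hn : 0 < n) (hM : Odd M)
    (hnM : 9 * n ≤ M) {x : Fin n → ℤ} (hx : x ∈ smallVectors n) :
    ((n * m).choose m : ℝ) * ((#(orthogonalRows M x) : ℝ) / (2 * M : ℝ) ^ n) ^ m ≤
      (1 / (3 * √(suppCard x + 1 : ℝ))) ^ m := by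
  simp only [smallVectors, mem_erase, Fintype.mem_piFinset, mem_Icc] at hx
  obtain ⟨j₀, hj₀⟩ := Function.ne_iff.1 hx.1
  have hM0 : (0 : ℝ) < M := by exact_mod_cast NeZero.pos M
  have hn0 : (0 : ℝ) < n := by exact_mod_cast hn
  have hM9 : 9 * (n : ℝ) ≤ M := by exact_mod_cast hnM
  have h := card_orthogonalRows_sqrt_le x j₀
    (isUnit_intCast_zmod hM hj₀ (hx.2 j₀).1 (hx.2 j₀).2)
  have hs : 0 < √(suppCard x + 1 : ℝ) := by positivity
  have hp : (#(orthogonalRows M x) : ℝ) / (2 * M : ℝ) ^ n ≤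
      1 / (M * √(suppCard x + 1 : ℝ)) := by
    rw [div_le_div_iff₀ (by positivity) (by positivity)]
    linarith
  calc _ ≤ (3 * n : ℝ) ^ m * (1 / (M * √(suppCard x + 1 : ℝ))) ^ m := by
        gcongr
        exact choose_mul_le n m
    _ = (3 * n / M / √(suppCard x + 1 : ℝ)) ^ m := by
        rw [← mul_pow]; congr 1; field_simp
    _ ≤ (1 / 3 / √(suppCard x + 1 : ℝ)) ^ m := by
        have h3 : 3 * (n : ℝ) / M ≤ 1 / 3 := by
          rw [div_le_div_iff₀ hM0 (by norm_num)]
          linarith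
        gcongr
    _ = _ := by rw [div_div]

/-- Vectors with at most `√n` non-zero entries are few, and for them the factor `3⁻ᵐ` suffices; for
the others the factor `(s + 1)^(-m/2)` beats the number `5ⁿ` of all vectors. -/
theorem sum_inv_sqrt_pow_lt {n m : ℕ} (hn : 2 ≤ n) (hm : 32 * ((n : ℝ) / Real.log n) ≤ m) :
    ∑ x ∈ smallVectors n, (1 / (3 * √(suppCard x + 1 : ℝ))) ^ m < 1 := by
  have hn2 : (2 : ℝ) ≤ n := by exact_mod_cast hn
  have hn0 : (0 : ℝ) < n := by linarith
  have hlog : 0 < Real.log n := Real.log_pos (by linarith)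
  have hlogle : Real.log n ≤ n := (Real.log_le_sub_one_of_pos hn0).trans (by linarith)
  have hq : 1 ≤ (n : ℝ) / Real.log n := (one_le_div hlog).2 hlogle
  have hr : 0 < √(n : ℝ) := Real.sqrt_pos.2 hn0
  -- `log n ≤ 4 n^(1/4)`, hence `√n log n ≤ 16 n / log n`.
  have hroot : √(n : ℝ) * Real.log n ≤ 16 * ((n : ℝ) / Real.log n) := by
    have hrr : 0 < √√(n : ℝ) := Real.sqrt_pos.2 hr
    have h1 : Real.log n ≤ 4 * √√(n : ℝ) := by
      have h2 : Real.log √√(n : ℝ) = Real.log n / 4 := by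
        rw [Real.log_sqrt hr.le, Real.log_sqrt hn0.le]; ring
      have := Real.log_le_sub_one_of_pos hrr
      linarith
    rw [← mul_div_assoc, le_div_iff₀ hlog]
    have h3 : Real.log n * Real.log n ≤ 16 * √(n : ℝ) := by
      calc Real.log n * Real.log n ≤ (4 * √√(n : ℝ)) * (4 * √√(n : ℝ)) := by gcongr
        _ = 16 * (√√(n : ℝ) * √√(n : ℝ)) := by ring
        _ = 16 * √(n : ℝ) := by rw [Real.mul_self_sqrt hr.le]
    calc √(n : ℝ) * Real.log n * Real.log n = √(n : ℝ) * (Real.log n * Real.log n) := by ring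
      _ ≤ √(n : ℝ) * (16 * √(n : ℝ)) := by gcongr
      _ = 16 * (√(n : ℝ) * √(n : ℝ)) := by ring
      _ = 16 * n := by rw [Real.mul_self_sqrt hn0.le]
  have hmlog : 32 * (n : ℝ) ≤ m * Real.log n := by
    rw [← mul_div_assoc, div_le_iff₀ hlog] at hm
    exact hm
  -- `D n^(-s)` bounds the terms with `s ≤ √n` and the constant `E` the others.
  set D : ℝ := Real.exp (√(n : ℝ) * Real.log n - m) with hD
  set E : ℝ := Real.exp (-(m * Real.log n / 4)) with hE
  have hterm : ∀ x : Fin n → ℤ, (1 / (3 * √(suppCard x + 1 : ℝ))) ^ m ≤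
      D * (1 / n) ^ suppCard x + E * 1 ^ suppCard x := by
    intro x
    set s := suppCard x
    have hD0 : 0 < D := Real.exp_pos _
    have hE0 : 0 < E := Real.exp_pos _
    have hs1 : 1 ≤ √(s + 1 : ℝ) := Real.one_le_sqrt.2 (by simp)
    rcases le_or_gt (s : ℝ) √(n : ℝ) with hs | hs
    · have h3 : (1 / (3 * √(s + 1 : ℝ))) ^ m ≤ Real.exp (-m) := by
        have : 1 / (3 * √(s + 1 : ℝ)) ≤ Real.exp (-1) := by
          rw [Real.exp_neg, ← one_div]
          apply one_div_le_one_div_of_le (Real.exp_pos _)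
          have := Real.exp_one_lt_three
          linarith
        calc _ ≤ Real.exp (-1) ^ m := by gcongr
          _ = Real.exp (-m) := by rw [← Real.exp_nat_mul]; ring_nf
      have h4 : (1 / (n : ℝ)) ^ s = Real.exp (-(s * Real.log n)) := by
        rw [Real.exp_neg, Real.exp_nat_mul, Real.exp_log hn0, one_div, inv_pow]
      have h5 : Real.exp (-m) ≤ D * (1 / n) ^ s := by
        rw [h4, hD, ← Real.exp_add, Real.exp_le_exp]
        nlinarith
      have : 0 ≤ E * 1 ^ s := by positivity
      linarith
    · have h3 : (1 / (3 * √(s + 1 : ℝ))) ^ m ≤ E := by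
        have h4 : Real.exp (Real.log n / 4) ≤ 3 * √(s + 1 : ℝ) := by
          have : Real.log n / 4 = Real.log √√(n : ℝ) := by
            rw [Real.log_sqrt hr.le, Real.log_sqrt hn0.le]; ring
          rw [this, Real.exp_log (Real.sqrt_pos.2 hr)]
          have := Real.sqrt_le_sqrt (show √(n : ℝ) ≤ s + 1 by linarith)
          linarith
        calc _ ≤ (1 / Real.exp (Real.log n / 4)) ^ m := by
              gcongr
          _ = E := by
              rw [one_div, ← Real.exp_neg, ← Real.exp_nat_mul, hE]; ring_nf
      have : 0 ≤ D * (1 / n) ^ s := by positivity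
      simpa using h3.trans (by linarith : E ≤ D * (1 / n) ^ s + E)
  have hexp1 : Real.exp (-1) < 1 / 2 := by
    rw [Real.exp_neg, ← one_div]
    apply one_div_lt_one_div_of_lt (by norm_num)
    linarith [Real.add_one_lt_exp (one_ne_zero (α := ℝ))]
  have hfew : D * (1 + 4 * (1 / n)) ^ n < 1 / 2 := by
    have h1 : (1 + 4 * (1 / (n : ℝ))) ^ n ≤ Real.exp 4 := by
      calc (1 + 4 * (1 / (n : ℝ))) ^ n ≤ Real.exp (4 * (1 / n)) ^ n := by
            gcongr
            linarith [Real.add_one_le_exp (4 * (1 / (n : ℝ)))]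
        _ = Real.exp 4 := by
            rw [← Real.exp_nat_mul]; congr 1; field_simp
    calc _ ≤ D * Real.exp 4 := by gcongr
      _ = Real.exp (√(n : ℝ) * Real.log n - m + 4) := by rw [hD, ← Real.exp_add]
      _ ≤ Real.exp (-1) := Real.exp_le_exp.2 (by linarith)
      _ < _ := hexp1
  have hmany : E * (1 + 4 * 1) ^ n < 1 / 2 := by
    have h1 : (1 + 4 * 1 : ℝ) ^ n ≤ Real.exp (4 * n) := by
      calc (1 + 4 * 1 : ℝ) ^ n ≤ Real.exp 4 ^ n := by
            gcongr
            linarith [Real.add_one_le_exp (4 : ℝ)]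
        _ = Real.exp (4 * n) := by rw [← Real.exp_nat_mul]; ring_nf
    calc _ ≤ E * Real.exp (4 * n) := by gcongr
      _ = Real.exp (-(m * Real.log n / 4) + 4 * n) := by rw [hE, ← Real.exp_add]
      _ ≤ Real.exp (-1) := Real.exp_le_exp.2 (by linarith)
      _ < _ := hexp1
  calc _ ≤ ∑ x ∈ smallVectors n, (D * (1 / n) ^ suppCard x + E * 1 ^ suppCard x) :=
        sum_le_sum fun x _ => hterm x
    _ = D * ∑ x ∈ smallVectors n, (1 / (n : ℝ)) ^ suppCard x +
          E * ∑ x ∈ smallVectors n, (1 : ℝ) ^ suppCard x := by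
        rw [sum_add_distrib, mul_sum, mul_sum]
    _ ≤ D * (1 + 4 * (1 / n)) ^ n + E * (1 + 4 * 1) ^ n := by
        gcongr
        · exact sum_smallVectors_pow_le (by positivity)
        · exact sum_smallVectors_pow_le zero_le_one
    _ < 1 := by linarith

theorem exists_isRMDS {n m : ℕ} (hn : 2 ≤ n) (hm : 32 * ((n : ℝ) / Real.log n) ≤ m) :
    ∃ A : Matrix (Fin (n * m)) (Fin n) ℤ,
      IsRMDS 3 m A ∧ ∀ i j, |A i j| ≤ (2 * (10 * n + 1) : ℕ) := by
  have : NeZero (10 * n + 1) := ⟨by omega⟩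
  refine exists_isRMDS_of_sum_lt (Nat.le_mul_of_pos_left m (by omega)) ?_
  refine (sum_le_sum fun x hx => ?_).trans_lt (sum_inv_sqrt_pow_lt hn hm)
  exact union_bound_term_le (by omega) ⟨5 * n, by ring⟩ (by omega) hx

/-! ### The parameters of the circuit -/

theorem compCircuit_weightsLE {N n m W : ℕ} {A : Matrix (Fin N) (Fin n) ℤ} (hW : 1 ≤ W)
    (hA : ∀ i j, |A i j| ≤ (W : ℤ)) : (compCircuit m A).WeightsLE W := by
  have hform : ∀ l i k, |compForm A l i k| ≤ (W : ℤ) := by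
    rintro l i (k | k) <;> simp only [compForm] <;> split_ifs <;> simp [hA]
  refine ⟨fun p k => ?_, fun k => ?_⟩
  · obtain ⟨l, i, b⟩ := p
    cases b <;> simp [compCircuit, hform]
  · simpa [compCircuit] using hW

theorem compCircuit_size {n m : ℕ} (A : Matrix (Fin (n * m)) (Fin n) ℤ) :
    (compCircuit m A).size = 2 * n ^ 2 * m + 1 := by
  simp only [DepthTwoCircuit.size, Fintype.card_prod, Fintype.card_fin, Fintype.card_bool]
  ring

theorem mainTheorem5 :
    (∀ (n m : ℕ) (A : Matrix (Fin (n * m)) (Fin n) ℤ),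
      IsRMDS 3 m A → (compCircuit m A).ComputesCOMP) ∧
    ∃ C : ℝ, 0 < C ∧ ∀ n : ℕ, 2 ≤ n →
      ∃ (m W : ℕ) (A : Matrix (Fin (n * m)) (Fin n) ℤ),
        IsRMDS 3 m A ∧ (∀ i j, |A i j| ≤ (W : ℤ)) ∧
        (m : ℝ) ≤ C * ((n : ℝ) / Real.log n) ∧ (W : ℝ) ≤ C * (n : ℝ) ∧
        (compCircuit m A).ComputesCOMP ∧
        (compCircuit m A).WeightsLE W ∧
        (compCircuit m A).size = 2 * n ^ 2 * m + 1 ∧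
        ((compCircuit m A).size : ℝ) ≤ C * ((n : ℝ) ^ 3 / Real.log n) := by
  -- The size `2 n² m + 1` with `m ≤ 33 n / log n` gives the constant `2 * 33 + 1`.
  refine ⟨fun n m A hA => computesCOMP_of_isRMDS hA, 67, by norm_num, fun n hn => ?_⟩
  have hn2 : (2 : ℝ) ≤ n := by exact_mod_cast hn
  have hlog : 0 < Real.log n := Real.log_pos (by linarith)
  have hq : 1 ≤ (n : ℝ) / Real.log n := (one_le_div hlog).2
    ((Real.log_le_sub_one_of_pos (by linarith)).trans (by linarith))
  set q := (n : ℝ) / Real.log n with hqdef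
  set m := ⌈32 * q⌉₊
  have hm : (m : ℝ) ≤ 33 * q := by
    have := Nat.ceil_lt_add_one (show 0 ≤ 32 * q by linarith)
    linarith
  obtain ⟨A, hA, hAW⟩ := exists_isRMDS hn (Nat.le_ceil (32 * q))
  refine ⟨m, 2 * (10 * n + 1), A, hA, hAW, by linarith, ?_, computesCOMP_of_isRMDS hA,
    compCircuit_weightsLE (by omega) hAW, compCircuit_size A, ?_⟩
  · push_cast
    linarith
  · rw [compCircuit_size]
    push_cast
    have h1 : (n : ℝ) ^ 3 / Real.log n = n ^ 2 * q := by rw [hqdef]; ring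
    have h2 : 1 ≤ (n : ℝ) ^ 2 * q := one_le_mul_of_one_le_of_one_le (by nlinarith) hq
    have h3 : (n : ℝ) ^ 2 * m ≤ n ^ 2 * (33 * q) := by gcongr
    rw [h1]
    linarith
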